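/- **Setting.** Equip $SO(3)$ with the Riemannian metric $\langle RA,RB\rangle=\tfrac12\operatorname{tr}(A^TB)$ ($A,B$ skew-symmetric), whose geodesic distance is $d(R,Q)=\arccos\frac{\operatorname{tr}(R^TQ)-1}{2}$, and let $\nabla$ denote the Riemannian gradient. Let $\varepsilon>0$, let $\mathcal D_\varepsilon=\{R\in SO(3): d(I,R)<\frac{\pi}{2}-\varepsilon\}$, and write $\overline D_r=\{R\in SO(3): d(I,R)\le r\}$. Let $\mathcal P(\mathcal D_\varepsilon)$ be the set of Borel probability measures on $\mathcal D_\varepsilon$ with the narrow topology. Let $K(R,Q)=g(d(R,Q)^2)$ for $R,Q\in SO(3)$, where $g:[0,\infty)\to\mathbb R$ is differentiable with locally Lipschitz derivative. For a curve $\rho=(\rho_t)_{t\ge0}$ in $\mathcal P(\mathcal D_\varepsilon)$ put $v[\rho](R,t)=-\int_{\mathcal D_\varepsilon}\nabla_R K(R,Q)\,d\rho_t(Q)$. A curve $\rho\in C([0,\infty);\mathcal P(\mathcal D_\varepsilon))$ is a *global weak solution* of $\partial_t\rho+\nabla\cdot(\rho v)=0$, $v=-\nabla K*\rho$, if there is a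 unique map $\Psi:\operatorname{supp}(\rho_0)\times[0,\infty)\to\mathcal D_\varepsilon$ with $\Psi^0(R)=R$ and $\frac{d}{dt}\Psi^t(R)=v[\rho](\Psi^t(R),t)$ for all $R\in\operatorname{supp}(\rho_0)$, $t\ge0$, and moreover $\rho_t=\Psi^t\#\rho_0$ for all $t\ge 0$. Define $h(s)=\frac{s}{\sin s}\,g'(s^2)$ for $s>0$ and $h(0)=g'(0)$. **Proposition.** Let $r<\pi/4$ and $r<\pi/2-\varepsilon$. Suppose that $g'\ge0$ on $[0,\infty)$, that $g'$ is continuously differentiable on $[0,4r^2]$, that for every $a>0$ there is $0<b<a$ with $h(b)>0$, and that $h$ is non-decreasing on $[0,\pi-2\varepsilon)$, the range of possible distances between two points of $\mathcal D_\varepsilon$. Let $\rho\in C([0,\infty);\mathcal P(\mathcal D_\varepsilon))$ be a global weak solution whose initial datum satisfies $\operatorname{supp}(\rho_0)\subset\overline D_r$. Then for every $\delta>0$ with $h(\delta)>0$, $$\lim_{t\to\infty}\iint_{d(R_1,R_2)>2\delta}d\rho_t(R_1)\,d\rho_t(R_2)=0 .$$ -/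

import Mathlib

open MeasureTheory Filter Topology Set
open scoped Matrix

noncomputable section

namespace SO3Aggregation

/-- The rotation group `SO(3)`, with the topology induced from the space of `3 × 3` real matrices. -/
abbrev SO3 : Type := Matrix.specialOrthogonalGroup (Fin 3) ℝ

instance instMeasurableSpaceSO3 : MeasurableSpace SO3 := borel SO3

instance instBorelSpaceSO3 : BorelSpace SO3 := ⟨rfl⟩

/-- The intrinsic (geodesic) distance on `SO(3)` for the metric `⟨RA, RB⟩ = (1/2) tr (Aᵀ B)`:
the angle of the rotation `Rᵀ Q`. -/
def geoDist (R Q : SO3) : ℝ :=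
  Real.arccos (((R.1ᵀ * Q.1).trace - 1) / 2)

/-- The skew-symmetric matrix of a vector of `ℝ³`. The matrices `hat e₀, hat e₁, hat e₂` are an
orthonormal basis of `so(3)` for the inner product `(1/2) tr (Aᵀ B)`. -/
def hat (v : Fin 3 → ℝ) : Matrix (Fin 3) (Fin 3) ℝ :=
  !![0, -v 2, v 1; v 2, 0, -v 0; -v 1, v 0, 0]

theorem hat_transpose (v : Fin 3 → ℝ) : (hat v)ᵀ = -hat v := by
  ext i j
  fin_cases i <;> fin_cases j <;> simp [hat]

theorem exp_hat_mul_transpose (v : Fin 3 → ℝ) :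
    NormedSpace.exp (hat v) * (NormedSpace.exp (hat v))ᵀ = 1 := by
  rw [← Matrix.exp_transpose, hat_transpose,
    ← Matrix.exp_add_of_commute _ _ ((Commute.refl (hat v)).neg_right), add_neg_cancel,
    NormedSpace.exp_zero]

theorem exp_hat_mem (v : Fin 3 → ℝ) :
    NormedSpace.exp (hat v) ∈ Matrix.specialOrthogonalGroup (Fin 3) ℝ := by
  rw [Matrix.mem_specialOrthogonalGroup_iff, Matrix.mem_orthogonalGroup_iff]
  refine ⟨exp_hat_mul_transpose v, ?_⟩
  have h2 : hat v = (2 : ℕ) • hat ((1 / 2 : ℝ) • v) := by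
    ext i j
    fin_cases i <;> fin_cases j <;> simp [hat]
  have h3 := congrArg Matrix.det (exp_hat_mul_transpose ((1 / 2 : ℝ) • v))
  rw [Matrix.det_mul, Matrix.det_transpose, Matrix.det_one] at h3
  rw [h2, Matrix.exp_nsmul, Matrix.det_pow, sq, h3]

/-- The element `exp (hat v)` of `SO(3)`. -/
def expSO3 (v : Fin 3 → ℝ) : SO3 := ⟨NormedSpace.exp (hat v), exp_hat_mem v⟩

/-- The Riemannian gradient at `R` of a function `φ` on `SO(3)`, as a matrix in
`T_R SO(3) = {R A : A skew-symmetric}`. It is written in the orthonormal basis `R (hat eₖ)`, the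
coefficients being the derivatives of `φ` along the geodesics `s ↦ R exp (s (hat eₖ))`. -/
def riemGrad (φ : SO3 → ℝ) (R : SO3) : Matrix (Fin 3) (Fin 3) ℝ :=
  ∑ k : Fin 3,
    deriv (fun s : ℝ => φ (R * expSO3 (s • (Pi.single k 1 : Fin 3 → ℝ)))) 0 •
      (R.1 * hat (Pi.single k 1))

/-- The open geodesic disk of radius `π/2 - ε` centred at the identity. -/
abbrev Disk (ε : ℝ) : Type := {R : SO3 // geoDist 1 R < Real.pi / 2 - ε}

/-- The derivative of a function `g : [0, ∞) → ℝ` (one-sided at `0`); only the values of `g` on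
`[0, ∞)` matter. -/
def dg (g : ℝ → ℝ) (s : ℝ) : ℝ := derivWithin g (Ici 0) s

/-- `K(R, Q) = g(d(R, Q)²)` with `g : [0, ∞) → ℝ` differentiable and `g'` locally Lipschitz. -/
structure IsInteractionPotential (K : SO3 → SO3 → ℝ) (g : ℝ → ℝ) : Prop where
  eq_dist_sq : ∀ R Q, K R Q = g (geoDist R Q ^ 2)
  differentiableOn : DifferentiableOn ℝ g (Ici 0)
  locallyLipschitzOn : LocallyLipschitzOn (Ici 0) (dg g)

/-- The velocity `-∇K * μ`, i.e. `R ↦ -∫ ∇_R K(R, Q) dμ(Q)`, the integral of a matrix-valued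
function being taken entrywise. -/
def velocity {ε : ℝ} (K : SO3 → SO3 → ℝ) (μ : Measure (Disk ε)) (R : SO3) :
    Matrix (Fin 3) (Fin 3) ℝ :=
  Matrix.of fun i j => -∫ Q : Disk ε, riemGrad (fun R' => K R' Q.1) R i j ∂μ

/-- `Ψ` is a global flow map on `S × [0, ∞)`, with values in the disk, of the time-dependent vector
field `X`: `Ψ⁰(R) = R` and `(d/dt) Ψᵗ(R) = X_t(Ψᵗ(R))` for `R ∈ S`, `t ≥ 0` (the derivative of the
matrix `Ψᵗ(R)` is taken entrywise, and is one-sided at `t = 0`). -/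
def IsGlobalFlowMap {ε : ℝ} (X : ℝ → SO3 → Matrix (Fin 3) (Fin 3) ℝ) (S : Set (Disk ε))
    (Ψ : ℝ → Disk ε → Disk ε) : Prop :=
  ∀ R ∈ S, Ψ 0 R = R ∧ ∀ t : ℝ, 0 ≤ t → ∀ i j : Fin 3,
    HasDerivWithinAt (fun s => (Ψ s R).1.1 i j) (X t (Ψ t R).1 i j) (Ici 0) t

/-- `(ρ_t)_{t ≥ 0}` is a narrowly continuous curve of Borel probability measures on the disk that is
a global weak solution of `∂_t ρ + ∇ · (ρ v) = 0`, `v = -∇K * ρ`: the velocity field generates a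
unique flow map on `supp ρ₀ × [0, ∞)`, and `ρ_t` is the push-forward of `ρ₀` along it. -/
structure IsGlobalWeakSolution {ε : ℝ} (K : SO3 → SO3 → ℝ)
    (ρ : ℝ → ProbabilityMeasure (Disk ε)) : Prop where
  continuousOn : ContinuousOn ρ (Ici 0)
  exists_flow : ∃ Ψ : ℝ → Disk ε → Disk ε,
    IsGlobalFlowMap (fun t => velocity K (ρ t : Measure (Disk ε)))
      (ρ 0 : Measure (Disk ε)).support Ψ ∧
    (∀ Ψ' : ℝ → Disk ε → Disk ε,
      IsGlobalFlowMap (fun t => velocity K (ρ t : Measure (Disk ε)))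
        (ρ 0 : Measure (Disk ε)).support Ψ' →
      ∀ R ∈ (ρ 0 : Measure (Disk ε)).support, ∀ t : ℝ, 0 ≤ t → Ψ' t R = Ψ t R) ∧
    ∀ t : ℝ, 0 ≤ t → AEMeasurable (Ψ t) (ρ 0 : Measure (Disk ε)) ∧
      (ρ t : Measure (Disk ε)) = (ρ 0 : Measure (Disk ε)).map (Ψ t)

/-- `h(s) = (s / sin s) g'(s²)` for `s > 0`, and `h(0) = g'(0)`. -/
def hFun (g : ℝ → ℝ) (s : ℝ) : ℝ :=
  if s = 0 then dg g 0 else s / Real.sin s * dg g (s ^ 2)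

end SO3Aggregation

end

/-! The mean trace `L(t) = ∫ tr R dρ_t` is a bounded Lyapunov function. The pairwise force on `R`
exerted by `Q` is `F(d)(Q - R Qᵀ R)`, with `d` the distance from `R` to `Q` and `F(d) = d g'(d²) /
sin d`. After symmetrising in `R` and `Q`, `L'` is half the double integral of `F(d)` times
`traceGap R Q`. The geometric core is `pair_estimates`: lifting to unit quaternions shows that on
the disk `traceGap R Q ≥ 4 sin²ε (3 - tr(RᵀQ))`, so `L` is non-decreasing.

Monotonicity of `h` gives `F(d) ≥ h(δ) > 0` once `d > δ`. Hence `L'` dominates a positive multiple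
`W(t)` of the double integral of `excess δ`, the positive part of `2 (cos δ - cos d)`. The velocity
is bounded on the disk, so `W` can only decrease at a bounded rate; a Barbalat argument
(`tendsto_zero_of_le_deriv`) then forces `W → 0`. Since `excess δ` is bounded below where `d > 2δ`,
Markov's inequality concludes. -/

namespace SO3Aggregation

/-! ### Rotations and their quaternion lifts. -/

theorem abs_entry_le_one (R : SO3) (i j : Fin 3) : |R.1 i j| ≤ 1 := by
  have h := entry_norm_bound_of_unitary (𝕜 := ℝ) (U := R.1)
    (Matrix.mem_specialOrthogonalGroup_iff.1 R.2).1 i j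
  simpa using h

theorem mul_transpose_self (R : SO3) : R.1 * R.1ᵀ = 1 :=
  (Matrix.mem_orthogonalGroup_iff (Fin 3) ℝ).1 (Matrix.mem_specialOrthogonalGroup_iff.1 R.2).1

theorem transpose_mul_self (R : SO3) : R.1ᵀ * R.1 = 1 :=
  (Matrix.mem_orthogonalGroup_iff' (Fin 3) ℝ).1 (Matrix.mem_specialOrthogonalGroup_iff.1 R.2).1

theorem adjugate_eq_transpose (R : SO3) : R.1.adjugate = R.1ᵀ := by
  have h : R.1 * R.1.adjugate = 1 := by
    rw [Matrix.mul_adjugate, (Matrix.mem_specialOrthogonalGroup_iff.1 R.2).2, one_smul]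
  calc R.1.adjugate = R.1ᵀ * R.1 * R.1.adjugate := by rw [transpose_mul_self, one_mul]
    _ = R.1ᵀ := by rw [mul_assoc, h, mul_one]

/-- The (homogeneous) Euler–Rodrigues matrix of the quaternion `a + b i + c j + d k`. -/
def quatMatrix (a b c d : ℝ) : Matrix (Fin 3) (Fin 3) ℝ :=
  !![a ^ 2 + b ^ 2 - c ^ 2 - d ^ 2, 2 * (b * c - a * d), 2 * (b * d + a * c);
     2 * (b * c + a * d), a ^ 2 - b ^ 2 + c ^ 2 - d ^ 2, 2 * (c * d - a * b);
     2 * (b * d - a * c), 2 * (c * d + a * b), a ^ 2 - b ^ 2 - c ^ 2 + d ^ 2]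

/-- Away from half-turns `T = 1 + tr R = 4a²` is positive, and the skew part of `R` gives `4ab`,
`4ac`, `4ad`. The products among `b`, `c`, `d` follow from `adjugate R = Rᵀ` combined with
orthonormality of rows and columns. Requiring `a > 0` selects one of the two lifts `±q`. -/
theorem exists_eq_quatMatrix (R : SO3) (h : -1 < R.1.trace) :
    ∃ a b c d : ℝ, 0 < a ∧ a ^ 2 + b ^ 2 + c ^ 2 + d ^ 2 = 1 ∧ R.1 = quatMatrix a b c d := by
  have hadj := adjugate_eq_transpose R
  have hrow := mul_transpose_self R
  have hcol := transpose_mul_self R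
  generalize R.1 = A at *
  rw [Matrix.adjugate_fin_three] at hadj
  rw [← Matrix.ext_iff] at hadj hrow hcol
  simp only [Fin.forall_fin_succ, Matrix.mul_apply, Fin.sum_univ_three, Matrix.transpose_apply,
    Matrix.one_apply, Matrix.of_apply] at hadj hrow hcol
  simp at hadj hrow hcol
  rw [Matrix.trace_fin_three] at h
  obtain ⟨⟨c00, c01, c02⟩, ⟨c10, c11, c12⟩, c20, c21, c22⟩ := hadj
  obtain ⟨⟨r00, r01, r02⟩, ⟨r10, r11, r12⟩, r20, r21, r22⟩ := hrow
  obtain ⟨⟨k00, k01, k02⟩, ⟨k10, k11, k12⟩, k20, k21, k22⟩ := hcol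
  set T : ℝ := 1 + (A 0 0 + A 1 1 + A 2 2) with hT
  have hTpos : 0 < T := by linarith
  set s := √T with hs
  have hspos : 0 < s := Real.sqrt_pos.2 hTpos
  have hss : s ^ 2 = T := Real.sq_sqrt hTpos.le
  have e01 : (A 2 1 - A 1 2) * (A 0 2 - A 2 0) = T * (A 0 1 + A 1 0) := by
    linear_combination c01 + c10 - k01 - r01
  have e02 : (A 2 1 - A 1 2) * (A 1 0 - A 0 1) = T * (A 0 2 + A 2 0) := by
    linear_combination c20 + c02 - r02 - k02
  have e12 : (A 0 2 - A 2 0) * (A 1 0 - A 0 1) = T * (A 1 2 + A 2 1) := by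
    linear_combination c12 + c21 - k12 - r12
  have e00 : (A 2 1 - A 1 2) ^ 2 = T * (1 + A 0 0 - A 1 1 - A 2 2) := by
    linear_combination 2 * c00 + k11 + k22 - r00
  have e11 : (A 0 2 - A 2 0) ^ 2 = T * (1 - A 0 0 + A 1 1 - A 2 2) := by
    linear_combination 2 * c11 + k00 + k22 - r11
  have e22 : (A 1 0 - A 0 1) ^ 2 = T * (1 - A 0 0 - A 1 1 + A 2 2) := by
    linear_combination 2 * c22 + k00 + k11 - r22
  have hs0 : s ≠ 0 := hspos.ne'
  obtain ⟨a, ha⟩ : ∃ a, a = s / 2 := ⟨_, rfl⟩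
  obtain ⟨b, hb⟩ : ∃ b, b = (A 2 1 - A 1 2) / (2 * s) := ⟨_, rfl⟩
  obtain ⟨c, hc⟩ : ∃ c, c = (A 0 2 - A 2 0) / (2 * s) := ⟨_, rfl⟩
  obtain ⟨d, hd⟩ : ∃ d, d = (A 1 0 - A 0 1) / (2 * s) := ⟨_, rfl⟩
  have faa : 4 * (a * a) = T := by rw [ha, ← hss]; ring
  have fab : 4 * (a * b) = A 2 1 - A 1 2 := by rw [ha, hb]; field_simp; norm_num
  have fac : 4 * (a * c) = A 0 2 - A 2 0 := by rw [ha, hc]; field_simp; norm_num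
  have fad : 4 * (a * d) = A 1 0 - A 0 1 := by rw [ha, hd]; field_simp; norm_num
  have key : ∀ x y z : ℝ, x * y = T * z → 4 * (x / (2 * s) * (y / (2 * s))) = z := by
    intro x y z hxy
    rw [← hss] at hxy
    field_simp
    linear_combination 4 * hxy
  have fbb : 4 * (b * b) = 1 + A 0 0 - A 1 1 - A 2 2 := by
    rw [hb]; exact key _ _ _ (by rw [← e00]; ring)
  have fcc : 4 * (c * c) = 1 - A 0 0 + A 1 1 - A 2 2 := by
    rw [hc]; exact key _ _ _ (by rw [← e11]; ring)
  have fdd : 4 * (d * d) = 1 - A 0 0 - A 1 1 + A 2 2 := by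
    rw [hd]; exact key _ _ _ (by rw [← e22]; ring)
  have fbc : 4 * (b * c) = A 0 1 + A 1 0 := by rw [hb, hc]; exact key _ _ _ e01
  have fbd : 4 * (b * d) = A 0 2 + A 2 0 := by rw [hb, hd]; exact key _ _ _ e02
  have fcd : 4 * (c * d) = A 1 2 + A 2 1 := by rw [hc, hd]; exact key _ _ _ e12
  refine ⟨a, b, c, d, by rw [ha]; positivity, by linarith, ?_⟩
  ext i j
  fin_cases i <;> fin_cases j <;> simp [quatMatrix] <;> linarith

theorem trace_quatMatrix (a b c d : ℝ) :
    (quatMatrix a b c d).trace = 4 * a ^ 2 - (a ^ 2 + b ^ 2 + c ^ 2 + d ^ 2) := by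
  simp [quatMatrix, Matrix.trace_fin_three]; ring

theorem trace_transpose_quatMatrix_mul (a b c d a' b' c' d' : ℝ) :
    ((quatMatrix a b c d)ᵀ * quatMatrix a' b' c' d').trace =
      4 * (a * a' + b * b' + c * c' + d * d') ^ 2 -
        (a ^ 2 + b ^ 2 + c ^ 2 + d ^ 2) * (a' ^ 2 + b' ^ 2 + c' ^ 2 + d' ^ 2) := by
  simp [quatMatrix, Matrix.trace_fin_three, Matrix.mul_apply, Fin.sum_univ_three]; ring

/-- The product `R Qᵀ R` lifts to `q q̄' q = 2⟨q, q'⟩ q - |q|² q'`, whose real part is the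
expression being squared. -/
theorem trace_quatMatrix_mul_transpose_mul (a b c d a' b' c' d' : ℝ) :
    (quatMatrix a b c d * (quatMatrix a' b' c' d')ᵀ * quatMatrix a b c d).trace =
      4 * (2 * (a * a' + b * b' + c * c' + d * d') * a - a' * (a ^ 2 + b ^ 2 + c ^ 2 + d ^ 2)) ^ 2
        - (a ^ 2 + b ^ 2 + c ^ 2 + d ^ 2) ^ 2 * (a' ^ 2 + b' ^ 2 + c' ^ 2 + d' ^ 2) := by
  simp only [Matrix.trace_fin_three, Matrix.mul_apply, Fin.sum_univ_three, Matrix.transpose_apply]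
  simp [quatMatrix]
  ring

/-! ### Distance and trace estimates in the disk. -/

theorem geoDist_nonneg (R Q : SO3) : 0 ≤ geoDist R Q := Real.arccos_nonneg _

theorem geoDist_comm (R Q : SO3) : geoDist R Q = geoDist Q R := by
  unfold geoDist
  rw [← Matrix.trace_transpose, Matrix.transpose_mul, Matrix.transpose_transpose]

theorem lt_trace_of_geoDist_one_lt {ε : ℝ} (hε : 0 < ε) {R : SO3}
    (h : geoDist 1 R < Real.pi / 2 - ε) : 1 + 2 * Real.sin ε < R.1.trace := by
  have h0 := geoDist_nonneg 1 R
  by_contra! hle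
  have h1 : (R.1.trace - 1) / 2 ≤ Real.cos (Real.pi / 2 - ε) := by
    rw [Real.cos_pi_div_two_sub]; linarith
  have h2 := Real.antitone_arccos h1
  rw [Real.arccos_cos (by linarith) (by linarith [Real.pi_pos])] at h2
  have h3 : geoDist 1 R = Real.arccos ((R.1.trace - 1) / 2) := by simp [geoDist]
  linarith

/-- The second-order defect of the trace along the geodesic between two rotations. -/
def traceGap (R Q : SO3) : ℝ :=
  Q.1.trace + R.1.trace - (R.1 * Q.1ᵀ * R.1).trace - (Q.1 * R.1ᵀ * Q.1).trace

/-- For unit lifts with inner product `k`, `tr(RᵀQ) = 4k² - 1` and the gap equals `16 k (2aa' - k(a²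
+ a'²))`. Membership in the disk means `a², a'² > (1 + sin ε)/2`, which keeps both `k` and `2aa' -
k` above `sin ε`. -/
theorem pair_estimates {ε : ℝ} (hε : 0 < ε) {R Q : SO3}
    (hR : geoDist 1 R < Real.pi / 2 - ε) (hQ : geoDist 1 Q < Real.pi / 2 - ε) :
    4 * Real.sin ε ^ 2 - 1 < (R.1ᵀ * Q.1).trace ∧ (R.1ᵀ * Q.1).trace ≤ 3 ∧
      4 * Real.sin ε ^ 2 * (3 - (R.1ᵀ * Q.1).trace) ≤ traceGap R Q := by
  have hε2 : 0 < Real.sin ε :=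
    Real.sin_pos_of_pos_of_lt_pi hε (by linarith [geoDist_nonneg 1 R, Real.pi_pos])
  have tR := lt_trace_of_geoDist_one_lt hε hR
  have tQ := lt_trace_of_geoDist_one_lt hε hQ
  obtain ⟨a, b, c, d, ha, hn, hRq⟩ := exists_eq_quatMatrix R (by linarith)
  obtain ⟨a', b', c', d', ha', hn', hQq⟩ := exists_eq_quatMatrix Q (by linarith)
  have hcomm : a' * a + b' * b + c' * c + d' * d = a * a' + b * b' + c * c' + d * d' := by ring
  rw [hRq, trace_quatMatrix, hn] at tR
  rw [hQq, trace_quatMatrix, hn'] at tQ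
  rw [traceGap, hRq, hQq, trace_quatMatrix, trace_quatMatrix, trace_transpose_quatMatrix_mul,
    trace_quatMatrix_mul_transpose_mul, trace_quatMatrix_mul_transpose_mul, hn, hn', hcomm]
  set e := Real.sin ε
  set m := b * b' + c * c' + d * d' with hm
  set k := a * a' + b * b' + c * c' + d * d' with hk
  have hkm : k = a * a' + m := by rw [hk, hm]; ring
  have hu : (1 + e) / 2 < a ^ 2 := by linarith
  have hu' : (1 + e) / 2 < a' ^ 2 := by linarith
  have haa : (1 + e) / 2 < a * a' := by
    refine lt_of_pow_lt_pow_left₀ 2 (by positivity) ?_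
    rw [mul_pow, sq]
    exact mul_lt_mul'' hu hu' (by positivity) (by positivity)
  have he1 : e ≤ 1 := Real.sin_le_one _
  have hmm : m ^ 2 ≤ (b ^ 2 + c ^ 2 + d ^ 2) * (b' ^ 2 + c' ^ 2 + d' ^ 2) := by
    rw [hm]
    linear_combination sq_nonneg (b * c' - c * b') + sq_nonneg (b * d' - d * b') +
      sq_nonneg (c * d' - d * c')
  have hm2 : m ^ 2 ≤ ((1 - e) / 2) ^ 2 := by
    refine hmm.trans ?_
    rw [sq ((1 - e) / 2)]
    exact mul_le_mul (by linarith) (by linarith) (by positivity) (by linarith)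
  have hmabs := abs_le_of_sq_le_sq' hm2 (by linarith)
  have hk1 : e < k := by linarith [hmabs.1]
  have hk2 : e < 2 * (a * a') - k := by linarith [hmabs.2]
  -- This is the Gram determinant of the quaternions `1`, `q`, `q'`, nonnegative by Cauchy–Schwarz
  -- for the imaginary parts.
  have hgram : 0 ≤ 1 + 2 * k * (a * a') - a ^ 2 - a' ^ 2 - k ^ 2 := by
    have h1 : b ^ 2 + c ^ 2 + d ^ 2 = 1 - a ^ 2 := by linarith
    have h2 : b' ^ 2 + c' ^ 2 + d' ^ 2 = 1 - a' ^ 2 := by linarith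
    have h3 : m = k - a * a' := by linarith
    rw [h1, h2, h3] at hmm
    linear_combination hmm
  have hk_le : k ≤ 1 := by
    rw [hk]
    linarith [sq_nonneg (a - a'), sq_nonneg (b - b'), sq_nonneg (c - c'), sq_nonneg (d - d')]
  have hksq : k ^ 2 ≤ 1 := pow_le_one₀ (by linarith) hk_le
  have heksq : e ^ 2 < k ^ 2 := pow_lt_pow_left₀ hk1 hε2.le two_ne_zero
  refine ⟨by linarith, by linarith, ?_⟩
  -- The difference of the two sides is exactly `k` times the Gram determinant.
  have h1 : (1 - k ^ 2) * (2 * (a * a') - k) ≤ 2 * (a * a') - k * (a ^ 2 + a' ^ 2) := by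
    linear_combination mul_nonneg (hε2.trans hk1).le hgram
  have h2 : (1 - k ^ 2) * e ≤ 2 * (a * a') - k * (a ^ 2 + a' ^ 2) :=
    (mul_le_mul_of_nonneg_left hk2.le (by linarith)).trans h1
  have h3 : e * ((1 - k ^ 2) * e) ≤ k * (2 * (a * a') - k * (a ^ 2 + a' ^ 2)) :=
    mul_le_mul hk1.le h2 (mul_nonneg (by linarith) hε2.le) (by linarith)
  linear_combination 16 * h3

theorem cos_geoDist {R Q : SO3} (h1 : -1 ≤ (R.1ᵀ * Q.1).trace) (h3 : (R.1ᵀ * Q.1).trace ≤ 3) :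
    Real.cos (geoDist R Q) = ((R.1ᵀ * Q.1).trace - 1) / 2 :=
  Real.cos_arccos (by linarith) (by linarith)

/-- The lower trace bound of `pair_estimates` says `cos d > 2 sin²ε - 1 = cos(π - 2ε)`. -/
theorem geoDist_lt {ε : ℝ} (hε : 0 < ε) {R Q : SO3}
    (hR : geoDist 1 R < Real.pi / 2 - ε) (hQ : geoDist 1 Q < Real.pi / 2 - ε) :
    geoDist R Q < Real.pi - 2 * ε := by
  obtain ⟨h1, h3, -⟩ := pair_estimates hε hR hQ
  by_contra! hle
  have h0 := geoDist_nonneg 1 R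
  have h2 := Real.cos_le_cos_of_nonneg_of_le_pi (by linarith) (Real.arccos_le_pi _) hle
  have h4 := cos_geoDist (by nlinarith [sq_nonneg (Real.sin ε)]) h3
  rw [geoDist] at h4
  rw [Real.cos_pi_sub, Real.cos_two_mul, Real.cos_sq', h4] at h2
  linarith

theorem trace_sub_transpose_mul_sub (R Q : SO3) :
    ((R.1 - Q.1)ᵀ * (R.1 - Q.1)).trace = 6 - 2 * (R.1ᵀ * Q.1).trace := by
  have h : (Q.1ᵀ * R.1).trace = (R.1ᵀ * Q.1).trace := by
    rw [← Matrix.trace_transpose, Matrix.transpose_mul, Matrix.transpose_transpose]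
  rw [Matrix.transpose_sub, Matrix.sub_mul, Matrix.mul_sub, Matrix.mul_sub, transpose_mul_self,
    transpose_mul_self, Matrix.trace_sub, Matrix.trace_sub, Matrix.trace_sub, h]
  simp
  ring

theorem trace_transpose_mul_le_three (R Q : SO3) : (R.1ᵀ * Q.1).trace ≤ 3 := by
  have h := trace_sub_transpose_mul_sub R Q
  have h2 : 0 ≤ ((R.1 - Q.1)ᵀ * (R.1 - Q.1)).trace := by
    simp only [Matrix.trace, Matrix.diag_apply, Matrix.mul_apply, Matrix.transpose_apply]
    exact Finset.sum_nonneg fun i _ => Finset.sum_nonneg fun j _ => mul_self_nonneg _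
  linarith

theorem eq_of_trace_transpose_mul_eq_three {R Q : SO3} (h : (R.1ᵀ * Q.1).trace = 3) : R = Q := by
  have h1 := trace_sub_transpose_mul_sub R Q
  rw [h] at h1
  have h2 := (Matrix.trace_conjTranspose_mul_self_eq_zero_iff (A := R.1 - Q.1)).1 (by
    rw [Matrix.conjTranspose_eq_transpose_of_trivial, h1]; norm_num)
  exact Subtype.ext (sub_eq_zero.1 h2)

/-! ### Gradient of the interaction potential. -/

theorem hat_smul (s : ℝ) (v : Fin 3 → ℝ) : hat (s • v) = s • hat v := by
  ext i j
  fin_cases i <;> fin_cases j <;> simp [hat]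

theorem expSO3_neg_transpose (v : Fin 3 → ℝ) : (expSO3 (-v)).1 = (expSO3 v).1ᵀ := by
  have h : hat (-v) = (hat v)ᵀ := by
    rw [hat_transpose, ← neg_one_smul ℝ v, hat_smul, neg_one_smul]
  change NormedSpace.exp (hat (-v)) = (NormedSpace.exp (hat v))ᵀ
  rw [h, Matrix.exp_transpose]

theorem hasDerivAt_exp_smul_apply (X : Matrix (Fin 3) (Fin 3) ℝ) (i j : Fin 3) :
    HasDerivAt (fun s : ℝ => NormedSpace.exp (s • X) i j) (X i j) 0 := by
  let : NormedRing (Matrix (Fin 3) (Fin 3) ℝ) := Matrix.linftyOpNormedRing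
  let : NormedAlgebra ℝ (Matrix (Fin 3) (Fin 3) ℝ) := Matrix.linftyOpNormedAlgebra
  have h := hasDerivAt_exp_smul_const (𝕂 := ℝ) X 0
  rw [zero_smul, NormedSpace.exp_zero, one_mul] at h
  let e : Matrix (Fin 3) (Fin 3) ℝ →L[ℝ] ℝ :=
    LinearMap.toContinuousLinearMap (Matrix.entryLinearMap ℝ ℝ i j)
  exact e.hasFDerivAt.comp_hasDerivAt 0 h

theorem hasDerivAt_trace_mul_expSO3 (R Q : SO3) (v : Fin 3 → ℝ) :
    HasDerivAt (fun s : ℝ => ((R * expSO3 (s • v)).1ᵀ * Q.1).trace)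
      ((hat v)ᵀ * (R.1ᵀ * Q.1)).trace 0 := by
  have h : ∀ s : ℝ, ((R * expSO3 (s • v)).1ᵀ * Q.1).trace =
      ∑ i, ∑ j, NormedSpace.exp (s • hat v) j i * (R.1ᵀ * Q.1) j i := by
    intro s
    have : (R * expSO3 (s • v)).1 = R.1 * NormedSpace.exp (s • hat v) := by
      rw [← hat_smul]; rfl
    rw [this, Matrix.transpose_mul, mul_assoc, Matrix.trace]
    simp [Matrix.mul_apply]
  simp_rw [h]
  have h2 : ((hat v)ᵀ * (R.1ᵀ * Q.1)).trace = ∑ i, ∑ j, hat v j i * (R.1ᵀ * Q.1) j i := by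
    rw [Matrix.trace]
    simp [Matrix.mul_apply]
  rw [h2]
  exact HasDerivAt.fun_sum fun i _ => HasDerivAt.fun_sum fun j _ =>
    (hasDerivAt_exp_smul_apply (hat v) j i).mul_const _

/-- The basis is orthonormal for half the trace form, so the sum is twice the projection `(A -
Aᵀ)/2` onto skew matrices. -/
theorem sum_trace_hat_smul_hat (A : Matrix (Fin 3) (Fin 3) ℝ) :
    ∑ k : Fin 3, ((hat (Pi.single k 1))ᵀ * A).trace • hat (Pi.single k 1) = A - Aᵀ := by
  ext i j
  fin_cases i <;> fin_cases j <;>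
    simp [hat, Matrix.trace_fin_three, Matrix.mul_apply, Fin.sum_univ_three, Pi.single_apply] <;>
    ring

/-- The radial profile `θ g'(θ²) / sin θ` of the interaction force. -/
noncomputable def radialForce (g : ℝ → ℝ) (θ : ℝ) : ℝ := θ / Real.sin θ * dg g (θ ^ 2)

/-- Off the diagonal this is the chain rule through `arccos`, which is smooth since the trace lies
strictly between `-1` and `3`. On the diagonal `arccos` is singular, but a symmetry makes both sides
zero. -/
theorem deriv_interaction {K : SO3 → SO3 → ℝ} {g : ℝ → ℝ} (hK : IsInteractionPotential K g)
    {R Q : SO3} (h : -1 < (R.1ᵀ * Q.1).trace) (v : Fin 3 → ℝ) :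
    deriv (fun s : ℝ => K (R * expSO3 (s • v)) Q) 0 =
      -(radialForce g (geoDist R Q) * ((hat v)ᵀ * (R.1ᵀ * Q.1)).trace) := by
  simp_rw [hK.eq_dist_sq]
  rcases (trace_transpose_mul_le_three R Q).eq_or_lt with h3 | h3
  · obtain rfl := eq_of_trace_transpose_mul_eq_three h3
    have hA : ∀ s : ℝ, ((R * expSO3 (s • v)).1ᵀ * R.1).trace = (expSO3 (s • v)).1.trace := by
      intro s
      change ((R.1 * (expSO3 (s • v)).1)ᵀ * R.1).trace = _
      rw [Matrix.transpose_mul, mul_assoc, transpose_mul_self, mul_one, Matrix.trace_transpose]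
    -- The function is even in `s`, so its `deriv` at `0` equals its own negative; no
    -- differentiability is needed.
    have h0 := deriv_comp_neg (fun s : ℝ => g (geoDist (R * expSO3 (s • v)) R ^ 2)) 0
    have heven : ∀ s : ℝ, g (geoDist (R * expSO3 (-s • v)) R ^ 2) =
        g (geoDist (R * expSO3 (s • v)) R ^ 2) := by
      intro s
      simp only [geoDist, hA]
      rw [neg_smul, expSO3_neg_transpose, Matrix.trace_transpose]
    simp only [heven, neg_zero] at h0
    have h1 : ((hat v)ᵀ * (R.1ᵀ * R.1)).trace = 0 := by
      rw [transpose_mul_self, mul_one, Matrix.trace_fin_three]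
      simp [hat]
    rw [h1, mul_zero, neg_zero]
    linarith
  · have hu1 : -1 < ((R.1ᵀ * Q.1).trace - 1) / 2 := by linarith
    have hu2 : ((R.1ᵀ * Q.1).trace - 1) / 2 < 1 := by linarith
    have hpos : 0 < geoDist R Q := Real.arccos_pos.2 hu2
    have hzero : (R * expSO3 ((0 : ℝ) • v)) = R := by
      apply Subtype.ext
      change R.1 * NormedSpace.exp (hat ((0 : ℝ) • v)) = R.1
      rw [hat_smul, zero_smul, NormedSpace.exp_zero, mul_one]
    have hg : HasDerivAt g (dg g (geoDist R Q ^ 2)) (geoDist R Q ^ 2) :=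
      ((hK.differentiableOn _ (by simp [sq_nonneg])).hasDerivWithinAt).hasDerivAt
        (Ici_mem_nhds (by positivity))
    have ht := ((hasDerivAt_trace_mul_expSO3 R Q v).sub_const 1).div_const 2
    have harc : HasDerivAt (fun s : ℝ => geoDist (R * expSO3 (s • v)) Q)
        (-(1 / Real.sin (geoDist R Q)) * (((hat v)ᵀ * (R.1ᵀ * Q.1)).trace / 2)) 0 := by
      have h1 := Real.hasDerivAt_arccos hu1.ne' hu2.ne
      rw [← Real.sin_arccos] at h1
      refine HasDerivAt.comp (h₂ := Real.arccos) 0 ?_ ht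
      rw [hzero]
      exact h1
    have hsq := harc.pow 2
    have hfin : HasDerivAt (fun s : ℝ => g (geoDist (R * expSO3 (s • v)) Q ^ 2)) _ 0 :=
      HasDerivAt.comp (h₂ := g) 0 (by
        rw [hzero]
        exact hg) hsq
    rw [hfin.deriv, hzero, radialForce]
    simp
    ring

theorem riemGrad_interaction {K : SO3 → SO3 → ℝ} {g : ℝ → ℝ} (hK : IsInteractionPotential K g)
    {R Q : SO3} (h : -1 < (R.1ᵀ * Q.1).trace) :
    riemGrad (fun R' => K R' Q) R =
      -(radialForce g (geoDist R Q) • (Q.1 - R.1 * Q.1ᵀ * R.1)) := by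
  have h1 : Q.1 - R.1 * Q.1ᵀ * R.1 = R.1 * (R.1ᵀ * Q.1 - (R.1ᵀ * Q.1)ᵀ) := by
    rw [Matrix.mul_sub, ← mul_assoc, mul_transpose_self, one_mul, Matrix.transpose_mul,
      Matrix.transpose_transpose, mul_assoc]
  rw [h1, ← sum_trace_hat_smul_hat, Matrix.mul_sum, Finset.smul_sum, ← Finset.sum_neg_distrib,
    riemGrad]
  refine Finset.sum_congr rfl fun k _ => ?_
  rw [deriv_interaction hK h, Matrix.mul_smul, neg_smul, mul_smul]

/-! ### A Barbalat-type lemma. -/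

/-- A Lipschitz nonnegative function dominated by the derivative of a function that is bounded
above tends to zero. -/
theorem tendsto_zero_of_le_deriv {L L' W : ℝ → ℝ} {B C : ℝ} (hC : 0 < C)
    (hL : ∀ t, 0 < t → HasDerivAt L (L' t) t) (hB : ∀ t, 0 < t → L t ≤ B)
    (hW : ∀ t, 0 < t → 0 ≤ W t) (hLW : ∀ t, 0 < t → W t ≤ L' t)
    (hLip : ∀ s t, 0 < s → s ≤ t → W s - W t ≤ C * (t - s)) :
    Tendsto W atTop (𝓝 0) := by
  have hmvt : ∀ m s t : ℝ, 0 < s → s ≤ t → (∀ x, s ≤ x → x ≤ t → m ≤ L' x) →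
      m * (t - s) ≤ L t - L s := by
    intro m s t hs hst hm
    have hd : ∀ x ∈ Icc s t, HasDerivAt L (L' x) x := fun x hx => hL x (hs.trans_le hx.1)
    refine (convex_Icc s t).mul_sub_le_image_sub_of_le_deriv
      (fun x hx => (hd x hx).continuousAt.continuousWithinAt)
      (fun x hx => (hd x (interior_subset hx)).differentiableAt.differentiableWithinAt)
      (fun x hx => ?_) s (left_mem_Icc.2 hst) t (right_mem_Icc.2 hst) hst
    rw [(hd x (interior_subset hx)).deriv]
    exact hm x (interior_subset hx).1 (interior_subset hx).2
  -- Truncating at time `1` keeps to positive times, the only ones covered by the hypotheses.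
  have hmono : Monotone fun t => L (max t 1) := by
    intro s t hst
    have h1 : (0 : ℝ) < max s 1 := lt_max_of_lt_right one_pos
    have := hmvt 0 (max s 1) (max t 1) h1 (max_le_max_right 1 hst) fun x hx _ =>
      (hW x (h1.trans_le hx)).trans (hLW x (h1.trans_le hx))
    linarith
  have hlim := tendsto_atTop_ciSup hmono ⟨B, by
    rintro _ ⟨t, rfl⟩
    exact hB _ (lt_max_of_lt_right one_pos)⟩
  rw [Metric.tendsto_atTop]
  intro η hη
  -- Over a time `τ = η/(2C)` the function `W` loses at most `η/2`, so `W t ≥ η` would make `L` gain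
  -- at least `τη/2`, contradicting its convergence.
  have hτ : 0 < η / (2 * C) := by positivity
  set τ := η / (2 * C) with hτdef
  have hCτ : C * τ = η / 2 := by rw [hτdef]; field_simp
  have hdiff := (hlim.comp (tendsto_atTop_add_const_right atTop τ tendsto_id)).sub hlim
  rw [sub_self] at hdiff
  obtain ⟨N, hN⟩ := eventually_atTop.1
    (hdiff.eventually (gt_mem_nhds (show 0 < τ * (η / 2) by positivity)))
  refine ⟨max N 1, fun t ht => ?_⟩
  have ht1 : 1 ≤ t := (le_max_right _ _).trans ht
  have h := hN t ((le_max_left _ _).trans ht)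
  simp only [Function.comp_apply, id] at h
  rw [max_eq_left ht1, max_eq_left (by linarith)] at h
  have h2 := hmvt (W t - C * τ) t (t + τ) (by linarith) (by linarith) fun x hx1 hx2 => by
    have h3 := hLip t x (by linarith) hx1
    have h4 := hLW x (by linarith)
    have h5 : C * (x - t) ≤ C * τ := mul_le_mul_of_nonneg_left (by linarith) hC.le
    linarith
  rw [Real.dist_eq, sub_zero, abs_of_nonneg (hW t (by linarith))]
  rw [add_sub_cancel_left, mul_comm] at h2
  have h6 := lt_of_mul_lt_mul_left (h2.trans_lt h) hτ.le
  linarith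

/-! ### Regularity and bounds of the pairwise force. -/

instance (ε : ℝ) : SecondCountableTopology (Disk ε) := by
  have h : SecondCountableTopology (Matrix (Fin 3) (Fin 3) ℝ) :=
    inferInstanceAs (SecondCountableTopology (Fin 3 → Fin 3 → ℝ))
  have h2 : SecondCountableTopology SO3 := TopologicalSpace.Subtype.secondCountableTopology _
  exact TopologicalSpace.Subtype.secondCountableTopology _

theorem continuous_geoDist {ε : ℝ} : Continuous fun p : Disk ε × Disk ε => geoDist p.1.1 p.2.1 := by
  unfold geoDist
  have : Continuous fun p : Disk ε × Disk ε => (p.1.1.1ᵀ * p.2.1.1).trace := by fun_prop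
  exact Real.continuous_arccos.comp (by fun_prop)

theorem measurable_radialForce {K : SO3 → SO3 → ℝ} {g : ℝ → ℝ} (hK : IsInteractionPotential K g) :
    Measurable (radialForce g) := by
  have h : Continuous fun θ : ℝ => dg g (θ ^ 2) :=
    hK.locallyLipschitzOn.continuousOn.comp_continuous (by fun_prop) fun θ => sq_nonneg θ
  exact (measurable_id.div Real.measurable_sin).mul h.measurable

theorem radialForce_nonneg {g : ℝ → ℝ} (hg : ∀ s : ℝ, 0 ≤ s → 0 ≤ dg g s) (R Q : SO3) :
    0 ≤ radialForce g (geoDist R Q) :=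
  mul_nonneg (div_nonneg (geoDist_nonneg R Q)
    (Real.sin_nonneg_of_nonneg_of_le_pi (geoDist_nonneg R Q) (Real.arccos_le_pi _)))
    (hg _ (sq_nonneg _))

/-- Distances in the disk stay below `π - 2ε`, so `sin θ = 2 sin(θ/2) cos(θ/2)` is controlled by
Jordan's inequality `sin(θ/2) ≥ θ/π` and by `cos(θ/2) ≥ sin ε`. The factor `g'` is bounded on the
compact `[0, π²]`. -/
theorem exists_radialForce_le {K : SO3 → SO3 → ℝ} {g : ℝ → ℝ} {ε : ℝ}
    (hK : IsInteractionPotential K g) (hg : ∀ s : ℝ, 0 ≤ s → 0 ≤ dg g s) (hε : 0 < ε) :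
    ∃ C, 0 < C ∧ ∀ R Q : Disk ε, |radialForce g (geoDist R.1 Q.1)| ≤ C := by
  obtain ⟨D, hD⟩ := (isCompact_Icc (a := (0 : ℝ)) (b := Real.pi ^ 2)).bddAbove_image
    (hK.locallyLipschitzOn.continuousOn.mono Icc_subset_Ici_self)
  have hD' : ∀ x ∈ Icc 0 (Real.pi ^ 2), dg g x ≤ D := fun x hx => hD (mem_image_of_mem _ hx)
  have hD0 : 0 ≤ D := (hg 0 le_rfl).trans (hD' 0 ⟨le_rfl, sq_nonneg _⟩)
  by_cases hne : Nonempty (Disk ε)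
  swap
  · exact ⟨1, one_pos, fun R => (hne ⟨R⟩).elim⟩
  obtain ⟨R₀⟩ := hne
  have hε2 : ε < Real.pi / 2 := by linarith [geoDist_nonneg 1 R₀.1, R₀.2]
  have hsin : 0 < Real.sin ε := Real.sin_pos_of_pos_of_lt_pi hε (by linarith)
  refine ⟨Real.pi / (2 * Real.sin ε) * D + 1, by positivity, fun R Q => ?_⟩
  rw [abs_of_nonneg (radialForce_nonneg hg _ _)]
  have hlt := geoDist_lt hε R.2 Q.2
  have h0 := geoDist_nonneg R.1 Q.1
  have hpi : geoDist R.1 Q.1 ≤ Real.pi := Real.arccos_le_pi _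
  generalize geoDist R.1 Q.1 = θ at *
  have hs : θ / Real.sin θ ≤ Real.pi / (2 * Real.sin ε) := by
    rcases h0.eq_or_lt with rfl | hpos
    · rw [zero_div]; positivity
    have h1 : 2 / Real.pi * (θ / 2) ≤ Real.sin (θ / 2) :=
      Real.mul_le_sin (by linarith) (by linarith)
    have h2 : Real.sin ε ≤ Real.cos (θ / 2) := by
      rw [← Real.cos_pi_div_two_sub]
      exact Real.cos_le_cos_of_nonneg_of_le_pi (by linarith) (by linarith) (by linarith)
    have h3 : Real.sin θ = 2 * Real.sin (θ / 2) * Real.cos (θ / 2) := by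
      rw [← Real.sin_two_mul]; ring_nf
    have h4 : 2 / Real.pi * (θ / 2) * Real.sin ε ≤ Real.sin (θ / 2) * Real.cos (θ / 2) :=
      mul_le_mul h1 h2 hsin.le (le_trans (by positivity) h1)
    rw [div_le_div_iff₀ (Real.sin_pos_of_pos_of_lt_pi hpos (by linarith)) (by positivity), h3]
    have h5 : 2 / Real.pi * (θ / 2) * Real.sin ε * Real.pi = θ * Real.sin ε := by
      field_simp
    have h6 := mul_le_mul_of_nonneg_right h4 Real.pi_pos.le
    linarith
  have h7 : dg g (θ ^ 2) ≤ D := hD' _ ⟨sq_nonneg _, pow_le_pow_left₀ h0 hpi 2⟩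
  have := mul_le_mul hs h7 (hg _ (sq_nonneg _)) (by positivity)
  rw [radialForce]
  linarith

/-- The pairwise force exerted on `R` by `Q`. -/
noncomputable def force (g : ℝ → ℝ) {ε : ℝ} (R Q : Disk ε) : Matrix (Fin 3) (Fin 3) ℝ :=
  radialForce g (geoDist R.1 Q.1) • (Q.1.1 - R.1.1 * Q.1.1ᵀ * R.1.1)

theorem measurable_force {K : SO3 → SO3 → ℝ} {g : ℝ → ℝ} {ε : ℝ}
    (hK : IsInteractionPotential K g) (i j : Fin 3) :
    Measurable fun p : Disk ε × Disk ε => force g p.1 p.2 i j := by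
  have h : Continuous fun p : Disk ε × Disk ε =>
      (p.2.1.1 - p.1.1.1 * p.2.1.1ᵀ * p.1.1.1) i j := by fun_prop
  exact ((measurable_radialForce hK).comp continuous_geoDist.measurable).mul h.measurable

theorem abs_force_le {g : ℝ → ℝ} {ε C : ℝ}
    (hC : ∀ R Q : Disk ε, |radialForce g (geoDist R.1 Q.1)| ≤ C) (R Q : Disk ε) (i j : Fin 3) :
    |force g R Q i j| ≤ C * 2 := by
  have h : |(Q.1.1 - R.1.1 * Q.1.1ᵀ * R.1.1) i j| ≤ 2 := by
    have h1 : R.1.1 * Q.1.1ᵀ * R.1.1 = (R.1 * Q.1⁻¹ * R.1).1 := rfl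
    rw [h1, Matrix.sub_apply]
    have h2 := abs_sub (Q.1.1 i j) ((R.1 * Q.1⁻¹ * R.1).1 i j)
    linarith [abs_entry_le_one Q.1 i j, abs_entry_le_one (R.1 * Q.1⁻¹ * R.1) i j]
  rw [force, Matrix.smul_apply, smul_eq_mul, abs_mul]
  exact mul_le_mul (hC R Q) h (abs_nonneg _) ((abs_nonneg _).trans (hC R Q))

theorem velocity_apply {K : SO3 → SO3 → ℝ} {g : ℝ → ℝ} {ε : ℝ} (hε : 0 < ε)
    (hK : IsInteractionPotential K g) (μ : Measure (Disk ε)) (R : Disk ε) (i j : Fin 3) :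
    velocity K μ R.1 i j = ∫ Q, force g R Q i j ∂μ := by
  rw [velocity, Matrix.of_apply, ← integral_neg]
  refine integral_congr_ae (Eventually.of_forall fun Q => ?_)
  have h := (pair_estimates hε R.2 Q.2).1
  simp only
  rw [riemGrad_interaction hK (by linarith [sq_nonneg (Real.sin ε)]), Matrix.neg_apply, neg_neg,
    force]

theorem trace_force_add (g : ℝ → ℝ) {ε : ℝ} (R Q : Disk ε) :
    (force g R Q).trace + (force g Q R).trace =
      radialForce g (geoDist R.1 Q.1) * traceGap R.1 Q.1 := by
  simp only [force, traceGap, Matrix.trace_smul, Matrix.trace_sub, geoDist_comm Q.1 R.1,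
    smul_eq_mul]
  ring

/-! ### The cut-off and its domination by the force. -/

/-- A Lipschitz cut-off, positive exactly at the pairs at distance greater than `δ`. -/
noncomputable def excess (δ : ℝ) {ε : ℝ} (R Q : Disk ε) : ℝ :=
  max 0 (1 + 2 * Real.cos δ - (R.1.1ᵀ * Q.1.1).trace)

theorem excess_nonneg (δ : ℝ) {ε : ℝ} (R Q : Disk ε) : 0 ≤ excess δ R Q := le_max_left _ _

theorem continuous_excess (δ ε : ℝ) :
    Continuous fun p : Disk ε × Disk ε => excess δ p.1 p.2 := by
  have : Continuous fun p : Disk ε × Disk ε => (p.1.1.1ᵀ * p.2.1.1).trace := by fun_prop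
  unfold excess
  fun_prop

theorem trace_eq_geoDist {ε : ℝ} (hε : 0 < ε) (R Q : Disk ε) :
    (R.1.1ᵀ * Q.1.1).trace = 1 + 2 * Real.cos (geoDist R.1 Q.1) := by
  have h := pair_estimates hε R.2 Q.2
  rw [cos_geoDist (by linarith [h.1, sq_nonneg (Real.sin ε)]) h.2.1]
  ring

/-- Within distance `δ` the cut-off vanishes and the symmetrised force is nonnegative. Beyond `δ`,
monotonicity of `h` bounds the radial factor below by `h(δ)` and `pair_estimates` bounds the gap. -/
theorem excess_le_force {g : ℝ → ℝ} {ε δ : ℝ} (hε : 0 < ε)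
    (hg : ∀ s : ℝ, 0 ≤ s → 0 ≤ dg g s)
    (hh : MonotoneOn (hFun g) (Ico 0 (Real.pi - 2 * ε))) (hδ : 0 < δ)
    (hδ' : δ < Real.pi - 2 * ε) (R Q : Disk ε) :
    4 * Real.sin ε ^ 2 * hFun g δ * excess δ R Q ≤
      (force g R Q).trace + (force g Q R).trace := by
  rw [trace_force_add]
  obtain ⟨h1, h3, hgap⟩ := pair_estimates hε R.2 Q.2
  have hF := radialForce_nonneg hg R.1 Q.1
  have hgap0 : 0 ≤ traceGap R.1 Q.1 :=
    (mul_nonneg (by positivity) (by linarith)).trans hgap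
  have htr := trace_eq_geoDist hε R Q
  rcases le_or_gt (geoDist R.1 Q.1) δ with hle | hlt
  · have hcos := Real.cos_le_cos_of_nonneg_of_le_pi (geoDist_nonneg R.1 Q.1) (by linarith) hle
    rw [excess, max_eq_left (by linarith), mul_zero]
    exact mul_nonneg hF hgap0
  · have hmono : hFun g δ ≤ radialForce g (geoDist R.1 Q.1) := by
      have := hh ⟨hδ.le, hδ'⟩ ⟨geoDist_nonneg R.1 Q.1, geoDist_lt hε R.2 Q.2⟩ hlt.le
      -- `hFun` and `radialForce` agree at nonzero distance; at `0` the latter takes the value `0`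
      -- from `0 / 0`.
      rwa [hFun, hFun, if_neg (hδ.trans hlt).ne', ← hFun] at this
    have hex : excess δ R Q ≤ 3 - (R.1.1ᵀ * Q.1.1).trace :=
      max_le (by linarith) (by linarith [Real.cos_le_one δ])
    calc 4 * Real.sin ε ^ 2 * hFun g δ * excess δ R Q
        = hFun g δ * (4 * Real.sin ε ^ 2 * excess δ R Q) := by ring
      _ ≤ radialForce g (geoDist R.1 Q.1) * traceGap R.1 Q.1 :=
        mul_le_mul hmono ((mul_le_mul_of_nonneg_left hex (by positivity)).trans hgap)
          (mul_nonneg (by positivity) (excess_nonneg _ _ _)) hF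

theorem le_excess_of_lt_geoDist {ε δ : ℝ} (hε : 0 < ε) (hδ : 0 < δ) {R Q : Disk ε}
    (h : 2 * δ < geoDist R.1 Q.1) : 2 * (Real.cos δ - Real.cos (2 * δ)) ≤ excess δ R Q := by
  have hcos := Real.cos_le_cos_of_nonneg_of_le_pi (by linarith) (Real.arccos_le_pi _) h.le
  rw [← geoDist] at hcos
  rw [excess, trace_eq_geoDist hε]
  exact le_max_of_le_right (by linarith)

theorem integral_le_integral_add_const {α : Type*} [MeasurableSpace α] {μ : Measure α}
    [IsProbabilityMeasure μ] {f h : α → ℝ} {c : ℝ} (hf : Integrable f μ) (hh : Integrable h μ)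
    (hle : ∀ᵐ x ∂μ, f x ≤ h x + c) : ∫ x, f x ∂μ ≤ ∫ x, h x ∂μ + c := by
  have h1 := integral_mono_ae hf (hh.add (integrable_const c)) hle
  simpa [integral_add hh (integrable_const c)] using h1

theorem integral_eq_integral_comp_of_eq_map {α β : Type*} [MeasurableSpace α] [MeasurableSpace β]
    {μ : Measure α} {ν : Measure β} {φ : α → β} (h : AEMeasurable φ μ ∧ ν = μ.map φ) {f : β → ℝ}
    (hf : StronglyMeasurable f) : ∫ y, f y ∂ν = ∫ x, f (φ x) ∂μ := by
  rw [h.2, integral_map h.1 hf.aestronglyMeasurable]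

theorem excess_le_four (δ : ℝ) {ε : ℝ} (hε : 0 < ε) (R Q : Disk ε) : excess δ R Q ≤ 4 := by
  have h := (pair_estimates hε R.2 Q.2).1
  exact max_le (by norm_num) (by linarith [sq_nonneg (Real.sin ε), Real.cos_le_one δ])

theorem norm_excess_le (δ : ℝ) {ε : ℝ} (hε : 0 < ε) (R Q : Disk ε) : ‖excess δ R Q‖ ≤ 4 := by
  rw [Real.norm_of_nonneg (excess_nonneg δ R Q)]
  exact excess_le_four δ hε R Q

theorem excess_le_excess_add (δ : ℝ) {ε d : ℝ} {R Q R' Q' : Disk ε}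
    (hR : ∀ i j, |R.1.1 i j - R'.1.1 i j| ≤ d) (hQ : ∀ i j, |Q.1.1 i j - Q'.1.1 i j| ≤ d) :
    excess δ R Q ≤ excess δ R' Q' + 18 * d := by
  have hd : 0 ≤ d := (abs_nonneg _).trans (hR 0 0)
  have hterm : ∀ i j, R'.1.1 j i * Q'.1.1 j i - R.1.1 j i * Q.1.1 j i ≤ 2 * d := by
    intro i j
    have h1 : |(R.1.1 j i - R'.1.1 j i) * Q'.1.1 j i| ≤ d * 1 := by
      rw [abs_mul]
      exact mul_le_mul (hR j i) (abs_entry_le_one _ _ _) (abs_nonneg _) hd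
    have h2 : |(Q.1.1 j i - Q'.1.1 j i) * R.1.1 j i| ≤ d * 1 := by
      rw [abs_mul]
      exact mul_le_mul (hQ j i) (abs_entry_le_one _ _ _) (abs_nonneg _) hd
    linarith [(abs_le.1 h1).1, (abs_le.1 h2).1]
  -- Each of the nine products of entries changes by at most `2d`.
  have htr : (R'.1.1ᵀ * Q'.1.1).trace - (R.1.1ᵀ * Q.1.1).trace ≤ 18 * d := by
    have h : ∀ A B : Matrix (Fin 3) (Fin 3) ℝ, (Aᵀ * B).trace = ∑ i, ∑ j, A j i * B j i := by
      intro A B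
      simp [Matrix.trace, Matrix.mul_apply]
    rw [h, h, ← Finset.sum_sub_distrib]
    simp_rw [← Finset.sum_sub_distrib]
    refine (Finset.sum_le_sum fun i _ => Finset.sum_le_sum fun j _ => hterm i j).trans ?_
    simp
    linarith
  have h1 := le_max_left 0 (1 + 2 * Real.cos δ - (R'.1.1ᵀ * Q'.1.1).trace)
  have h2 := le_max_right 0 (1 + 2 * Real.cos δ - (R'.1.1ᵀ * Q'.1.1).trace)
  unfold excess
  exact max_le (by linarith) (by linarith)

/-! ### Evolution along the flow. -/

section Flow

variable {K : SO3 → SO3 → ℝ} {g : ℝ → ℝ} {ε C : ℝ} {ρ : ℝ → ProbabilityMeasure (Disk ε)}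
  {Ψ : ℝ → Disk ε → Disk ε}

theorem abs_velocity_le (hε : 0 < ε) (hK : IsInteractionPotential K g)
    (hC : ∀ R Q : Disk ε, |radialForce g (geoDist R.1 Q.1)| ≤ C) (μ : Measure (Disk ε))
    [IsProbabilityMeasure μ] (R : Disk ε) (i j : Fin 3) : |velocity K μ R.1 i j| ≤ C * 2 := by
  rw [velocity_apply hε hK]
  have h := norm_integral_le_of_norm_le_const (μ := μ) (f := fun Q => force g R Q i j)
    (C := C * 2) (Eventually.of_forall fun Q => abs_force_le hC R Q i j)
  simpa using h

theorem flow_entry_lipschitz (hε : 0 < ε) (hK : IsInteractionPotential K g)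
    (hC : ∀ R Q : Disk ε, |radialForce g (geoDist R.1 Q.1)| ≤ C) {S : Set (Disk ε)}
    (hΨ : IsGlobalFlowMap (fun t => velocity K (ρ t : Measure (Disk ε))) S Ψ)
    {R : Disk ε} (hR : R ∈ S) {s t : ℝ} (hs : 0 ≤ s) (hst : s ≤ t) (i j : Fin 3) :
    |(Ψ s R).1.1 i j - (Ψ t R).1.1 i j| ≤ C * 2 * (t - s) := by
  have h := (convex_Ici (0 : ℝ)).norm_image_sub_le_of_norm_hasDerivWithin_le
    (f := fun s => (Ψ s R).1.1 i j) (C := C * 2)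
    (fun x hx => (hΨ R hR).2 x hx i j) (fun x _ => abs_velocity_le hε hK hC _ _ i j)
    (mem_Ici.2 hs) (mem_Ici.2 (hs.trans hst))
  rw [abs_sub_comm]
  simpa [abs_of_nonneg (sub_nonneg.2 hst)] using h

theorem measurable_trace_force (hK : IsInteractionPotential K g) :
    Measurable fun p : Disk ε × Disk ε => (force g p.1 p.2).trace :=
  Finset.measurable_sum _ fun i _ => measurable_force hK i i

theorem norm_trace_force_le (hC : ∀ R Q : Disk ε, |radialForce g (geoDist R.1 Q.1)| ≤ C)
    (R Q : Disk ε) : ‖(force g R Q).trace‖ ≤ C * 6 := by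
  refine (norm_sum_le _ _).trans
    ((Finset.sum_le_sum fun i _ => abs_force_le hC R Q i i).trans ?_)
  simp
  linarith

theorem trace_velocity (hε : 0 < ε) (hK : IsInteractionPotential K g)
    (hC : ∀ R Q : Disk ε, |radialForce g (geoDist R.1 Q.1)| ≤ C) (μ : Measure (Disk ε))
    [IsProbabilityMeasure μ] (R : Disk ε) :
    (velocity K μ R.1).trace = ∫ Q, (force g R Q).trace ∂μ := by
  simp only [Matrix.trace, Matrix.diag_apply]
  rw [integral_finsetSum]
  · exact Finset.sum_congr rfl fun i _ => velocity_apply hε hK μ R i i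
  · intro i _
    exact Integrable.of_bound
      ((measurable_force hK i i).comp measurable_prodMk_left).aestronglyMeasurable (C * 2)
      (Eventually.of_forall fun Q => abs_force_le hC R Q i i)

theorem norm_trace_le_three (R : SO3) : ‖R.1.trace‖ ≤ 3 := by
  refine (norm_sum_le _ _).trans
    ((Finset.sum_le_sum fun i _ => abs_entry_le_one R i i).trans ?_)
  simp

/-- The mean trace is differentiable along the flow. -/
theorem hasDerivAt_integral_trace (hε : 0 < ε) (hK : IsInteractionPotential K g)
    (hC : ∀ R Q : Disk ε, |radialForce g (geoDist R.1 Q.1)| ≤ C)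
    (hΨ : IsGlobalFlowMap (fun t => velocity K (ρ t : Measure (Disk ε)))
      (ρ 0 : Measure (Disk ε)).support Ψ)
    (hmap : ∀ t : ℝ, 0 ≤ t → AEMeasurable (Ψ t) (ρ 0 : Measure (Disk ε)) ∧
      (ρ t : Measure (Disk ε)) = (ρ 0 : Measure (Disk ε)).map (Ψ t)) {t : ℝ} (ht : 0 < t) :
    HasDerivAt (fun t => ∫ R, (Ψ t R).1.1.trace ∂(ρ 0 : Measure (Disk ε)))
      (∫ p, (force g p.1 p.2).trace ∂((ρ t : Measure (Disk ε)).prod (ρ t : Measure (Disk ε))))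
      t := by
  have hcont : Continuous fun R : Disk ε => R.1.1.trace := by fun_prop
  have hsupp : ∀ᵐ R ∂(ρ 0 : Measure (Disk ε)), R ∈ (ρ 0 : Measure (Disk ε)).support :=
    Measure.support_mem_ae
  have hmeas : StronglyMeasurable fun R : Disk ε =>
      ∫ Q, (force g R Q).trace ∂(ρ t : Measure (Disk ε)) :=
    (measurable_trace_force hK).stronglyMeasurable.integral_prod_right'
  have hbound : ∀ (s : ℝ) (R : Disk ε),
      ‖∫ Q, (force g R Q).trace ∂(ρ s : Measure (Disk ε))‖ ≤ C * 6 := by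
    intro s R
    have h := norm_integral_le_of_norm_le_const (μ := (ρ s : Measure (Disk ε)))
      (f := fun Q => (force g R Q).trace) (C := C * 6)
      (Eventually.of_forall fun Q => norm_trace_force_le hC R Q)
    simpa using h
  have hae : ∀ s, 0 ≤ s → AEStronglyMeasurable (fun R => (Ψ s R).1.1.trace)
      (ρ 0 : Measure (Disk ε)) := fun s hs =>
    (hcont.measurable.comp_aemeasurable (hmap s hs).1).aestronglyMeasurable
  -- Integrating against the fixed `ρ 0` leaves time only in the integrand. The flow equation is
  -- known only on the support, which has full measure.
  have h := (hasDerivAt_integral_of_dominated_loc_of_deriv_le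
    (μ := (ρ 0 : Measure (Disk ε))) (F := fun s R => (Ψ s R).1.1.trace)
    (F' := fun s R => ∫ Q, (force g (Ψ s R) Q).trace ∂(ρ s : Measure (Disk ε)))
    (bound := fun _ => C * 6) (Ioi_mem_nhds ht)
    (by filter_upwards [Ioi_mem_nhds ht] with s hs using hae s (le_of_lt hs))
    (Integrable.of_bound (hae t ht.le) 3
      (Eventually.of_forall fun R => norm_trace_le_three (Ψ t R).1))
    (hmeas.measurable.comp_aemeasurable (hmap t ht.le).1).aestronglyMeasurable
    (Eventually.of_forall fun R s _ => hbound s (Ψ s R))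
    (integrable_const _)
    (by
      filter_upwards [hsupp] with R hR s hs
      have hs0 : (0 : ℝ) < s := hs
      rw [← trace_velocity hε hK hC]
      exact HasDerivAt.fun_sum fun i _ =>
        ((hΨ R hR).2 s hs0.le i i).hasDerivAt (Ici_mem_nhds hs0))).2
  have hint : Integrable (fun p : Disk ε × Disk ε => (force g p.1 p.2).trace)
      ((ρ t : Measure (Disk ε)).prod (ρ t : Measure (Disk ε))) :=
    Integrable.of_bound (measurable_trace_force hK).aestronglyMeasurable (C * 6)
      (Eventually.of_forall fun p => norm_trace_force_le hC p.1 p.2)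
  rw [integral_prod _ hint, integral_eq_integral_comp_of_eq_map (hmap t ht.le) hmeas]
  exact h

theorem integrable_excess (δ : ℝ) (hε : 0 < ε) (ν : Measure (Disk ε × Disk ε))
    [IsFiniteMeasure ν] : Integrable (fun p : Disk ε × Disk ε => excess δ p.1 p.2) ν :=
  Integrable.of_bound (continuous_excess δ ε).aestronglyMeasurable 4
    (Eventually.of_forall fun p => norm_excess_le δ hε p.1 p.2)

/-- Both double integrals are pulled back to `ρ 0`. Matrix entries move at speed at most `2C` along
the flow, and `excess_le_excess_add` supplies the factor `18`. -/
theorem integral_excess_le (δ : ℝ) (hε : 0 < ε) (hK : IsInteractionPotential K g)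
    (hC : ∀ R Q : Disk ε, |radialForce g (geoDist R.1 Q.1)| ≤ C)
    (hΨ : IsGlobalFlowMap (fun t => velocity K (ρ t : Measure (Disk ε)))
      (ρ 0 : Measure (Disk ε)).support Ψ)
    (hmap : ∀ t : ℝ, 0 ≤ t → AEMeasurable (Ψ t) (ρ 0 : Measure (Disk ε)) ∧
      (ρ t : Measure (Disk ε)) = (ρ 0 : Measure (Disk ε)).map (Ψ t))
    {s t : ℝ} (hs : 0 ≤ s) (hst : s ≤ t) :
    ∫ p, excess δ p.1 p.2 ∂((ρ s : Measure (Disk ε)).prod (ρ s : Measure (Disk ε))) ≤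
      ∫ p, excess δ p.1 p.2 ∂((ρ t : Measure (Disk ε)).prod (ρ t : Measure (Disk ε))) +
        18 * (C * 2 * (t - s)) := by
  have hsupp : ∀ᵐ R ∂(ρ 0 : Measure (Disk ε)), R ∈ (ρ 0 : Measure (Disk ε)).support :=
    Measure.support_mem_ae
  have hmeas : ∀ u : ℝ, StronglyMeasurable fun R : Disk ε =>
      ∫ Q, excess δ R Q ∂(ρ u : Measure (Disk ε)) := fun u =>
    (continuous_excess δ ε).stronglyMeasurable.integral_prod_right'
  have hcont : ∀ R : Disk ε, Continuous fun Q => excess δ R Q := by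
    intro R
    have h := (continuous_excess δ ε).comp (Continuous.prodMk_right R)
    exact h
  have hinner : ∀ u, 0 ≤ u → ∀ R : Disk ε, ∫ Q, excess δ R Q ∂(ρ u : Measure (Disk ε)) =
      ∫ Q, excess δ R (Ψ u Q) ∂(ρ 0 : Measure (Disk ε)) := fun u hu R =>
    integral_eq_integral_comp_of_eq_map (hmap u hu) (hcont R).stronglyMeasurable
  have houter : ∀ u, 0 ≤ u →
      ∫ p, excess δ p.1 p.2 ∂((ρ u : Measure (Disk ε)).prod (ρ u : Measure (Disk ε))) =
        ∫ R, ∫ Q, excess δ (Ψ u R) Q ∂(ρ u : Measure (Disk ε)) ∂(ρ 0 : Measure (Disk ε)) := by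
    intro u hu
    rw [integral_prod _ (integrable_excess δ hε _)]
    exact integral_eq_integral_comp_of_eq_map (hmap u hu) (hmeas u)
  have hint_inner : ∀ u, 0 ≤ u → ∀ R : Disk ε,
      Integrable (fun Q => excess δ R (Ψ u Q)) (ρ 0 : Measure (Disk ε)) := by
    intro u hu R
    have hm := ((hcont R).measurable.comp_aemeasurable (hmap u hu).1).aestronglyMeasurable
    exact Integrable.of_bound hm 4 (Eventually.of_forall fun Q => norm_excess_le δ hε R (Ψ u Q))
  have hint_outer : ∀ u, 0 ≤ u → Integrable
      (fun R => ∫ Q, excess δ (Ψ u R) Q ∂(ρ u : Measure (Disk ε))) (ρ 0 : Measure (Disk ε)) := by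
    intro u hu
    have hm := ((hmeas u).measurable.comp_aemeasurable (hmap u hu).1).aestronglyMeasurable
    have hb : ∀ R, ‖∫ Q, excess δ (Ψ u R) Q ∂(ρ u : Measure (Disk ε))‖ ≤ 4 := by
      intro R
      have h := norm_integral_le_of_norm_le_const (μ := (ρ u : Measure (Disk ε)))
        (f := fun Q => excess δ (Ψ u R) Q) (C := 4)
        (Eventually.of_forall fun Q => norm_excess_le δ hε (Ψ u R) Q)
      simpa using h
    exact Integrable.of_bound hm 4 (Eventually.of_forall hb)
  have ht := hs.trans hst
  rw [houter s hs, houter t ht]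
  have hle : ∀ R ∈ (ρ 0 : Measure (Disk ε)).support,
      ∫ Q, excess δ (Ψ s R) Q ∂(ρ s : Measure (Disk ε)) ≤
        ∫ Q, excess δ (Ψ t R) Q ∂(ρ t : Measure (Disk ε)) + 18 * (C * 2 * (t - s)) := by
    intro R hR
    rw [hinner s hs, hinner t ht]
    have hle' : ∀ Q ∈ (ρ 0 : Measure (Disk ε)).support,
        excess δ (Ψ s R) (Ψ s Q) ≤ excess δ (Ψ t R) (Ψ t Q) + 18 * (C * 2 * (t - s)) :=
      fun Q hQ => excess_le_excess_add δ
        (fun i j => flow_entry_lipschitz hε hK hC hΨ hR hs hst i j)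
        (fun i j => flow_entry_lipschitz hε hK hC hΨ hQ hs hst i j)
    exact integral_le_integral_add_const (hint_inner s hs _) (hint_inner t ht _)
      (hsupp.mono hle')
  exact integral_le_integral_add_const (hint_outer s hs) (hint_outer t ht) (hsupp.mono hle)

/-- Swapping the two variables shows that the integral of the force trace is half that of its
symmetrisation, whence `2` in place of `4`. -/
theorem integral_excess_le_integral_force {δ : ℝ} (hε : 0 < ε) (hK : IsInteractionPotential K g)
    (hg : ∀ s : ℝ, 0 ≤ s → 0 ≤ dg g s)
    (hC : ∀ R Q : Disk ε, |radialForce g (geoDist R.1 Q.1)| ≤ C)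
    (hh : MonotoneOn (hFun g) (Ico 0 (Real.pi - 2 * ε))) (hδ : 0 < δ)
    (hδ' : δ < Real.pi - 2 * ε) (μ : Measure (Disk ε)) [IsProbabilityMeasure μ] :
    2 * Real.sin ε ^ 2 * hFun g δ * ∫ p, excess δ p.1 p.2 ∂(μ.prod μ) ≤
      ∫ p, (force g p.1 p.2).trace ∂(μ.prod μ) := by
  have hint : Integrable (fun p : Disk ε × Disk ε => (force g p.1 p.2).trace) (μ.prod μ) :=
    Integrable.of_bound (measurable_trace_force hK).aestronglyMeasurable (C * 6)
      (Eventually.of_forall fun p => norm_trace_force_le hC p.1 p.2)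
  have hswap : ∫ p, (force g p.2 p.1).trace ∂(μ.prod μ) =
      ∫ p, (force g p.1 p.2).trace ∂(μ.prod μ) :=
    integral_prod_swap (fun p : Disk ε × Disk ε => (force g p.1 p.2).trace)
  have hadd := integral_add hint hint.swap
  have hmono := integral_mono ((integrable_excess δ hε (μ.prod μ)).const_mul
    (4 * Real.sin ε ^ 2 * hFun g δ)) (hint.add hint.swap)
    fun p => excess_le_force hε hg hh hδ hδ' p.1 p.2
  rw [integral_const_mul] at hmono
  simp only [Pi.add_apply, Function.comp_apply, Prod.fst_swap, Prod.snd_swap] at hmono hadd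
  rw [hadd, hswap] at hmono
  linarith

theorem tendsto_integral_excess {δ : ℝ} (hε : 0 < ε) (hK : IsInteractionPotential K g)
    (hg : ∀ s : ℝ, 0 ≤ s → 0 ≤ dg g s)
    (hh : MonotoneOn (hFun g) (Ico 0 (Real.pi - 2 * ε)))
    (hsol : IsGlobalWeakSolution K ρ) (hδ : 0 < δ)
    (hδ' : δ < Real.pi - 2 * ε) (hδ_pos : 0 < hFun g δ) :
    Tendsto (fun t => ∫ p, excess δ p.1 p.2
      ∂((ρ t : Measure (Disk ε)).prod (ρ t : Measure (Disk ε)))) atTop (𝓝 0) := by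
  obtain ⟨Ψ, hΨ, -, hmap⟩ := hsol.exists_flow
  obtain ⟨C, hC0, hC⟩ := exists_radialForce_le (ε := ε) hK hg hε
  have hsin : 0 < Real.sin ε := Real.sin_pos_of_pos_of_lt_pi hε (by linarith)
  have hc : 0 < 2 * Real.sin ε ^ 2 * hFun g δ := by positivity
  set c := 2 * Real.sin ε ^ 2 * hFun g δ with hcdef
  have key := tendsto_zero_of_le_deriv
    (W := fun t => c * ∫ p, excess δ p.1 p.2
      ∂((ρ t : Measure (Disk ε)).prod (ρ t : Measure (Disk ε))))
    (B := 3) (C := c * (18 * (C * 2))) (by positivity)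
    (fun t ht => hasDerivAt_integral_trace hε hK hC hΨ hmap ht)
    (fun t _ => by
      have h := norm_integral_le_of_norm_le_const (μ := (ρ 0 : Measure (Disk ε)))
        (f := fun R => (Ψ t R).1.1.trace) (C := 3)
        (Eventually.of_forall fun R => norm_trace_le_three (Ψ t R).1)
      simpa using (le_abs_self _).trans h)
    (fun t _ => mul_nonneg hc.le (integral_nonneg fun p => excess_nonneg δ p.1 p.2))
    (fun t _ => integral_excess_le_integral_force hε hK hg hC hh hδ hδ' _)
    (fun s t hs hst => by
      have h := mul_le_mul_of_nonneg_left (integral_excess_le δ hε hK hC hΨ hmap hs.le hst) hc.le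
      linarith)
  simpa [hc.ne'] using key.const_mul c⁻¹

end Flow

end SO3Aggregation

/-! ### Conclusion by Markov's inequality. -/

theorem mainTheorem9 (K : SO3Aggregation.SO3 → SO3Aggregation.SO3 → ℝ) (g : ℝ → ℝ) (ε r δ : ℝ)
    (hK : SO3Aggregation.IsInteractionPotential K g)
    (hε : 0 < ε) (hr : r < Real.pi / 4) (hrε : r < Real.pi / 2 - ε)
    (hg_nonneg : ∀ s : ℝ, 0 ≤ s → 0 ≤ SO3Aggregation.dg g s)
    (hg_C1 : ContDiffOn ℝ 1 (SO3Aggregation.dg g) (Set.Icc 0 (4 * r ^ 2)))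
    (hh_pos : ∀ a : ℝ, 0 < a → ∃ b : ℝ, 0 < b ∧ b < a ∧ 0 < SO3Aggregation.hFun g b)
    (hh_mono : MonotoneOn (SO3Aggregation.hFun g) (Set.Ico 0 (Real.pi - 2 * ε)))
    (ρ : ℝ → ProbabilityMeasure (SO3Aggregation.Disk ε))
    (hsol : SO3Aggregation.IsGlobalWeakSolution K ρ)
    (hsupp : (ρ 0 : Measure (SO3Aggregation.Disk ε)).support ⊆
      {R | SO3Aggregation.geoDist 1 R.1 ≤ r})
    (hδ : 0 < δ) (hδ_pos : 0 < SO3Aggregation.hFun g δ) :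
    Tendsto
      (fun t : ℝ =>
        ((ρ t : Measure (SO3Aggregation.Disk ε)).prod (ρ t : Measure (SO3Aggregation.Disk ε)))
          {p | 2 * δ < SO3Aggregation.geoDist p.1.1 p.2.1})
      atTop (𝓝 0) := by
  -- If `2δ ≥ π - 2ε`, no two points of the disk are farther apart than `2δ`. Otherwise `δ` lies in
  -- the range where `h` is monotone, and `2δ < π` gives `cos 2δ < cos δ`.
  rcases le_or_gt (Real.pi - 2 * ε) (2 * δ) with hle | hlt
  · refine tendsto_const_nhds.congr fun t => ?_
    have hempty : {p : SO3Aggregation.Disk ε × SO3Aggregation.Disk ε |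
        2 * δ < SO3Aggregation.geoDist p.1.1 p.2.1} = ∅ :=
      eq_empty_of_forall_notMem fun p hp =>
        absurd (SO3Aggregation.geoDist_lt hε p.1.2 p.2.2) (not_lt.2 (hle.trans (le_of_lt hp)))
    rw [hempty, measure_empty]
  have hη : 0 < 2 * (Real.cos δ - Real.cos (2 * δ)) := by
    have := Real.cos_lt_cos_of_nonneg_of_le_pi hδ.le (by linarith) (by linarith : δ < 2 * δ)
    linarith
  have hW := SO3Aggregation.tendsto_integral_excess hε hK hg_nonneg hh_mono hsol hδ
    (by linarith) hδ_pos
  have hlim := ENNReal.tendsto_ofReal (hW.div_const (2 * (Real.cos δ - Real.cos (2 * δ))))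
  rw [zero_div, ENNReal.ofReal_zero] at hlim
  refine tendsto_of_tendsto_of_tendsto_of_le_of_le tendsto_const_nhds hlim
    (fun _ => zero_le) fun t => ?_
  have hint := SO3Aggregation.integrable_excess δ hε
    ((ρ t : Measure (SO3Aggregation.Disk ε)).prod (ρ t : Measure (SO3Aggregation.Disk ε)))
  generalize (ρ t : Measure (SO3Aggregation.Disk ε)).prod
    (ρ t : Measure (SO3Aggregation.Disk ε)) = ν at hint ⊢
  have hsub : {p : SO3Aggregation.Disk ε × SO3Aggregation.Disk ε |
      2 * δ < SO3Aggregation.geoDist p.1.1 p.2.1} ⊆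
      {p | 2 * (Real.cos δ - Real.cos (2 * δ)) ≤ SO3Aggregation.excess δ p.1 p.2} :=
    fun p hp => SO3Aggregation.le_excess_of_lt_geoDist hε hδ hp
  have hnonneg : ∀ p : SO3Aggregation.Disk ε × SO3Aggregation.Disk ε,
      0 ≤ SO3Aggregation.excess δ p.1 p.2 := fun p => SO3Aggregation.excess_nonneg δ p.1 p.2
  have hmarkov := meas_ge_le_lintegral_div (μ := ν)
    (f := fun p => ENNReal.ofReal (SO3Aggregation.excess δ p.1 p.2))
    hint.aestronglyMeasurable.aemeasurable.ennreal_ofReal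
    (ENNReal.ofReal_pos.2 hη).ne' ENNReal.ofReal_ne_top
  rw [← ofReal_integral_eq_lintegral_ofReal hint (Eventually.of_forall hnonneg),
    ← ENNReal.ofReal_div_of_pos hη] at hmarkov
  exact (measure_mono fun p hp => ENNReal.ofReal_le_ofReal (hsub hp)).trans hmarkov
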